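/- Let $A$ and $B$ be arbitrary groups and let $c\ge 1$. The free wreath product $A\,\mathrm{Wr}_*B$ is the semidirect product of the free product $C=\prod^{*}_{b\in B}A_b$ of copies $A_b=\{a_b : a\in A\}$ of $A$ by $B$, where $B$ acts by $b'^{-1}a_b\,b'=a_{bb'}$. For a group $G$ with a free presentation $G\cong F/R$ put $$\mathcal N_cM(G)=\frac{R\cap\gamma_{c+1}(F)}{[R,\,{}_cF]},\qquad [R,\,{}_cF]=[R,\underbrace{F,\dots,F}_{c}],$$ where $\gamma_{c+1}(F)$ is the $(c+1)$-st term of the lower central series ($\gamma_1(F)=F$), commutators of subgroups are left-normed, and $\oplus$ below denotes the direct product of groups; $\mathcal N_cM(G)$ does not depend, up to isomorphism, on the free presentation. Let $1\to R_1\to F_1\to A\to 1$ be a free presentation of $A$, let $K=F_1*B$ be the free product, write $X^K$ for the normal closure of $X$ in $K$, and put $$E_c=[R_1,K]^K\cap\gamma_{c+1}(K)\cap[F_1,B],\qquad D_c=\prod_{\substack{G_1,\dots,G_c\in\{F_1,B\}\\ \exists j:\ G_j=B}}[R_1,G_1,\dots,G_c]^K ,$$ so that $D_c\le E_c$ are normal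 subgroups of $K$. Then, whatever free presentations of $A$ (the same one as for $E_c$ and $D_c$), $B$ and $A\,\mathrm{Wr}_*B$ are used, there is an epimorphism $$\mathcal N_cM(A\,\mathrm{Wr}_*B)\twoheadrightarrow \mathcal N_cM(A)\oplus\mathcal N_cM(B)\oplus \frac{E_c}{D_c}.$$ Moreover, if $A\,\mathrm{Wr}_*B$ is finite or, more generally, if $\mathcal N_cM(A\,\mathrm{Wr}_*B)$ is finite, then the group on the right is isomorphic to a subgroup of $\mathcal N_cM(A\,\mathrm{Wr}_*B)$. -/

import Mathlib

noncomputable section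

namespace FreeWreathBaer

open Monoid Function

section Commutators

variable {G : Type*} [Group G]

/-- The left-normed commutator subgroup `[H, X₁, …, Xₙ] = [… [[H, X₁], X₂], …, Xₙ]`. -/
def leftNormed (H : Subgroup G) (l : List (Subgroup G)) : Subgroup G :=
  l.foldl (fun X Y => ⁅X, Y⁆) H

/-- `[R, _c G] = [R, G, …, G]`, with `c` entries equal to `G`. -/
def engelComm (c : ℕ) (R : Subgroup G) : Subgroup G :=
  leftNormed R (List.replicate c ⊤)

/-- `γ_{c+1}(G)`: Mathlib numbers the lower central series from `0`, so that its `c`-th term is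
the term which is classically written `γ_{c+1}(G)`. -/
def gammaSucc (c : ℕ) (G : Type*) [Group G] : Subgroup G :=
  (⊤ : Subgroup G).lowerCentralSeries c

theorem engelComm_succ (c : ℕ) (R : Subgroup G) :
    engelComm (c + 1) R = ⁅engelComm c R, ⊤⁆ := by
  simp [engelComm, leftNormed, List.replicate_succ']

instance engelComm_normal (c : ℕ) (R : Subgroup G) [R.Normal] : (engelComm c R).Normal := by
  induction c with
  | zero => simpa [engelComm, leftNormed]
  | succ c ih => rw [engelComm_succ]; infer_instance

theorem engelComm_le (c : ℕ) (R : Subgroup G) [R.Normal] :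
    engelComm c R ≤ R ⊓ gammaSucc c G := by
  induction c with
  | zero => simp [engelComm, leftNormed, gammaSucc]
  | succ c ih =>
    rw [engelComm_succ]
    exact le_inf ((Subgroup.commutator_le_left _ _).trans (ih.trans inf_le_left))
      (Subgroup.commutator_mono (ih.trans inf_le_right) le_rfl)

theorem leftNormed_cons (H X : Subgroup G) (l : List (Subgroup G)) :
    leftNormed H (X :: l) = leftNormed ⁅H, X⁆ l := rfl

theorem leftNormed_le_of_normal {N : Subgroup G} [N.Normal] (l : List (Subgroup G)) :
    ∀ {H : Subgroup G}, H ≤ N → leftNormed H l ≤ N := by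
  induction l with
  | nil => exact fun h => h
  | cons X l ih =>
    exact fun h => ih ((Subgroup.commutator_mono h le_rfl).trans (Subgroup.commutator_le_left _ _))

theorem leftNormed_le_gammaSucc (H : Subgroup G) (l : List (Subgroup G)) :
    leftNormed H l ≤ gammaSucc l.length G := by
  suffices h : ∀ (n : ℕ) (H : Subgroup G), H ≤ gammaSucc n G →
      leftNormed H l ≤ gammaSucc (n + l.length) G by
    simpa using h 0 H (by simp [gammaSucc])
  induction l with
  | nil => exact fun n H h => h
  | cons X l ih =>
    intro n H h
    have := ih (n + 1) ⁅H, X⁆ (Subgroup.commutator_mono h le_top)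
    rwa [add_assoc, add_comm 1] at this

/-- The section `H / N` of a group `G`, where `N` is normal in `G` (and `N ≤ H`
in all uses below). -/
abbrev Sec (H N : Subgroup G) : Type _ := H ⧸ N.subgroupOf H

end Commutators

/-- The `c`-nilpotent multiplier `𝒩_c M(G) = (R ∩ γ_{c+1}(F)) / [R, _c F]` of a group `G`, computed
from a free presentation `π : F → G` (`F` free, `π` surjective) with `R = ker π`. -/
abbrev NilMult (c : ℕ) {F G : Type*} [Group F] [Group G] (π : F →* G) : Type _ :=
  Sec (π.ker ⊓ gammaSucc c F) (engelComm c π.ker)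

section FreeWreath

variable (A B : Type*) [Group A] [Group B]

/-- The free product `C` of copies `A_b` of `A`, one for each `b ∈ B`. -/
abbrev FreePower : Type _ := CoprodI (fun _ : B => A)

variable {A B}

/-- The element `a_b` of the copy `A_b` of `A` in the free product. -/
def copy (b : B) (a : A) : FreePower A B := CoprodI.of (M := fun _ : B => A) (i := b) a

/-- The endomorphism `a_x ↦ a_{x b}` of the free product of the `A_x`. -/
def shift (b : B) : FreePower A B →* FreePower A B :=
  CoprodI.lift (fun x => CoprodI.of (M := fun _ : B => A) (i := x * b))

theorem shift_copy (b x : B) (a : A) : shift b (copy x a) = copy (x * b) a := by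
  simp [shift, copy]

theorem freePower_hom_ext {A B : Type*} [Group A] {N : Type*} [Monoid N]
    {f g : FreePower A B →* N} (h : ∀ b a, f (copy b a) = g (copy b a)) : f = g :=
  CoprodI.ext_hom _ _ fun b => MonoidHom.ext fun a => h b a

theorem shift_comp (b b' : B) : (shift b).comp (shift b') = (shift (b' * b) : FreePower A B →* _) :=
  freePower_hom_ext fun x a => by simp [shift_copy, mul_assoc]

theorem shift_one : shift 1 = MonoidHom.id (FreePower A B) :=
  freePower_hom_ext fun x a => by simp [shift_copy]

variable (A B)

/-- The action of `B` on the free product `C`, for Mathlib's convention that in a semidirect product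
`φ b` is the conjugation `n ↦ b n b⁻¹`: the element `b` acts by `a_x ↦ a_{x b⁻¹}`, so that in the
semidirect product `b⁻¹ a_x b = a_{x b}` (see `inr_inv_mul_copy_mul_inr`). -/
def shiftAut : B →* MulAut (FreePower A B) where
  toFun b := MonoidHom.toMulEquiv (shift b⁻¹) (shift b)
    (by rw [shift_comp, inv_mul_cancel, shift_one])
    (by rw [shift_comp, mul_inv_cancel, shift_one])
  map_one' := by
    ext x
    simp [shift_one]
  map_mul' b b' := by
    ext x
    have h := DFunLike.congr_fun (shift_comp (A := A) b⁻¹ b'⁻¹) x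
    simpa using h.symm

/-- The free wreath product `A Wr_* B`: the semidirect product of `C` by `B`. -/
abbrev FreeWreath : Type _ := FreePower A B ⋊[shiftAut A B] B

variable {A B}

theorem inr_inv_mul_copy_mul_inr (b x : B) (a : A) :
    (SemidirectProduct.inr b⁻¹ * SemidirectProduct.inl (copy x a) * SemidirectProduct.inr b :
      FreeWreath A B) = SemidirectProduct.inl (copy (x * b) a) := by
  have h := SemidirectProduct.inl_aut (φ := shiftAut A B) b⁻¹ (copy x a)
  rw [inv_inv] at h
  rw [← h]
  congr 1
  simp [shiftAut, shift_copy]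

end FreeWreath

section EcDc

variable {A F₁ : Type*} [Group A] [Group F₁] (B : Type*) [Group B] (c : ℕ) (π₁ : F₁ →* A)

/-- The copy of `R₁ = ker π₁` in the free product `K = F₁ * B`. -/
def relK : Subgroup (Coprod F₁ B) := π₁.ker.map Coprod.inl

variable (F₁) in
/-- The copy of `F₁` in `K = F₁ * B`. -/
def freeK : Subgroup (Coprod F₁ B) := (Coprod.inl : F₁ →* Coprod F₁ B).range

variable (F₁) in
/-- The copy of `B` in `K = F₁ * B`. -/
def topK : Subgroup (Coprod F₁ B) := (Coprod.inr : B →* Coprod F₁ B).range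

/-- `E_c = [R₁, K]^K ∩ γ_{c+1}(K) ∩ [F₁, B]`, a subgroup of `K = F₁ * B`; here `X^K` is the normal
closure of `X` in `K`. -/
def Ec : Subgroup (Coprod F₁ B) :=
  Subgroup.normalClosure (⁅relK B π₁, ⊤⁆ : Subgroup (Coprod F₁ B)) ⊓
    gammaSucc c (Coprod F₁ B) ⊓ ⁅freeK F₁ B, topK F₁ B⁆

/-- `D_c`, the product of the normal subgroups `[R₁, G₁, …, G_c]^K` of `K = F₁ * B` over all choices
of `G₁, …, G_c ∈ {F₁, B}` such that some `G_j` is `B`. -/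
def Dc : Subgroup (Coprod F₁ B) :=
  ⨆ (G : Fin c → Subgroup (Coprod F₁ B))
    (_ : (∀ i, G i = freeK F₁ B ∨ G i = topK F₁ B) ∧ ∃ j, G j = topK F₁ B),
    Subgroup.normalClosure (leftNormed (relK B π₁) (List.ofFn G) : Set (Coprod F₁ B))

instance Dc_normal : (Dc B c π₁).Normal := by
  unfold Dc; infer_instance

instance commutator_freeK_topK_normal : (⁅freeK F₁ B, topK F₁ B⁆).Normal := by
  have h : freeK F₁ B ⊔ topK F₁ B = ⊤ := Coprod.range_inl_sup_range_inr
  have h2 := Subgroup.normal_subgroupOf_commutator_sup (freeK F₁ B) (topK F₁ B)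
  rw [h] at h2
  exact (Subgroup.normal_subgroupOf_iff_le_normalizer le_top).mp h2 |> fun h3 =>
    Subgroup.normalizer_eq_top_iff.mp (top_le_iff.mp h3)

theorem leftNormed_le_commutator (l : List (Subgroup (Coprod F₁ B)))
    (hl : ∀ X ∈ l, X = freeK F₁ B ∨ X = topK F₁ B) (hB : topK F₁ B ∈ l) :
    ∀ H ≤ freeK F₁ B, leftNormed H l ≤ ⁅freeK F₁ B, topK F₁ B⁆ := by
  induction l with
  | nil => simp at hB
  | cons X l ih =>
    intro H hH
    rw [leftNormed_cons]
    by_cases hX : X = topK F₁ B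
    · subst hX
      exact leftNormed_le_of_normal l (Subgroup.commutator_mono hH le_rfl)
    · have hX' : X = freeK F₁ B := (hl X (by simp)).resolve_right hX
      refine ih (fun Y hY => hl Y (by simp [hY])) ?_ _ ?_
      · exact (List.mem_cons.mp hB).resolve_left fun h => hX h.symm
      · subst hX'
        exact (Subgroup.commutator_mono hH le_rfl).trans (Subgroup.commutator_le_self _)

theorem Dc_le_Ec : Dc B c π₁ ≤ Ec B c π₁ := by
  refine iSup₂_le fun G hG => ?_
  have hR : relK B π₁ ≤ freeK F₁ B := by
    rintro _ ⟨x, -, rfl⟩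
    exact ⟨x, rfl⟩
  have h1 : leftNormed (relK B π₁) (List.ofFn G) ≤
      Subgroup.normalClosure (⁅relK B π₁, ⊤⁆ : Subgroup (Coprod F₁ B)) := by
    obtain ⟨j, -⟩ := hG.2
    cases c with
    | zero => exact j.elim0
    | succ c =>
      rw [List.ofFn_succ, leftNormed_cons]
      exact leftNormed_le_of_normal _
        ((Subgroup.commutator_mono le_rfl le_top).trans Subgroup.le_normalClosure)
  have h2 : leftNormed (relK B π₁) (List.ofFn G) ≤ gammaSucc c (Coprod F₁ B) := by
    simpa using leftNormed_le_gammaSucc (relK B π₁) (List.ofFn G)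
  have h3 := leftNormed_le_commutator B (List.ofFn G)
    (fun X hX => by obtain ⟨i, rfl⟩ := List.mem_ofFn.mp hX; exact hG.1 i)
    (by obtain ⟨j, hj⟩ := hG.2; exact List.mem_ofFn.mpr ⟨j, hj⟩) _ hR
  have : (gammaSucc c (Coprod F₁ B)).Normal := by unfold gammaSucc; infer_instance
  have : (Ec B c π₁).Normal := by unfold Ec; infer_instance
  exact Subgroup.normalClosure_le_normal (le_inf (le_inf h1 h2) h3)

end EcDc

end FreeWreathBaer

end

noncomputable section

namespace FreeWreathBaer

open Monoid Function
open scoped commutatorElement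

/-! ### Commutator calculus modulo a normal subgroup. -/

section CommutatorCalculus

variable {G : Type*} [Group G]

/-! The assignment `a_b ↦ b⁻¹ a b` identifies `A Wr_* B` with the free product `A * B`, so
everything can be computed on `F₁ * F₂ → A * B`. Any two presentations give the same multiplier,
because homomorphisms that agree modulo `R` agree on `γ_{c+1}` modulo `[R, _c F]`
(`inv_mul_mem_engelComm`).

The projections of `A * B` give the first two components. For the third, pass to `K = F₁ * B`, write
`z̄` for the image of `z` under the retraction onto `F₁`, and send `z` to `z̄⁻¹ z`. The kernel of `K
→ A * B` is `R₁^K = R₁ D_1`, so `z̄⁻¹ z` lies in `E_c`. The map kills `[R₁^K, _c K]`, which lies in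
`[R₁, _c F₁] D_c`, since the retraction fixes the first factor and kills the second. It is
multiplicative modulo `D_c` because `[E_c, γ_{c+1}(K)] ≤ D_c`.

A finite multiplier is a finite abelian group, so its quotients embed in it by duality. If `A Wr_*
B` itself is finite, then `A` or `B` is trivial and the epimorphism is already injective. -/

theorem engelComm_add (m n : ℕ) (R : Subgroup G) :
    engelComm n (engelComm m R) = engelComm (m + n) R := by
  induction n with
  | zero => rfl
  | succ n ih => rw [engelComm_succ, ih, ← add_assoc, engelComm_succ]

theorem engelComm_antitone (R : Subgroup G) [R.Normal] :
    Antitone fun c => engelComm c R :=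
  antitone_nat_of_succ_le fun c => by
    rw [engelComm_succ]
    exact Subgroup.commutator_le_left _ _

theorem commutator_le_iff_map_eq_bot {H K N : Subgroup G} [N.Normal] :
    ⁅H, K⁆ ≤ N ↔ ⁅H.map (QuotientGroup.mk' N), K.map (QuotientGroup.mk' N)⁆ = ⊥ := by
  rw [← Subgroup.map_commutator, Subgroup.map_eq_bot_iff, QuotientGroup.ker_mk']

theorem commutator_commutator_le_of_rotate {H₁ H₂ H₃ N : Subgroup G} [N.Normal]
    (h₁ : ⁅⁅H₂, H₃⁆, H₁⁆ ≤ N) (h₂ : ⁅⁅H₃, H₁⁆, H₂⁆ ≤ N) : ⁅⁅H₁, H₂⁆, H₃⁆ ≤ N := by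
  rw [commutator_le_iff_map_eq_bot, Subgroup.map_commutator] at *
  exact Subgroup.commutator_commutator_eq_bot_of_rotate h₁ h₂

theorem commutator_sup_le {H X Y N : Subgroup G} [N.Normal] (hX : ⁅H, X⁆ ≤ N) (hY : ⁅H, Y⁆ ≤ N) :
    ⁅H, X ⊔ Y⁆ ≤ N := by
  rw [Subgroup.commutator_comm, commutator_le_iff_map_eq_bot,
    Subgroup.commutator_eq_bot_iff_le_centralizer] at *
  rw [Subgroup.map_sup]
  exact sup_le hX hY

/-- The hypothesis puts `S` in the preimage of the centre of `G ⧸ N`; that preimage is normal, so it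
contains the normal closure too. -/
theorem commutator_normalClosure_top_le {S N : Subgroup G} [N.Normal] (h : ⁅S, ⊤⁆ ≤ N) :
    ⁅Subgroup.normalClosure (S : Set G), ⊤⁆ ≤ N := by
  have key : ∀ T : Subgroup G,
      ⁅T, ⊤⁆ ≤ N ↔ T ≤ (Subgroup.center (G ⧸ N)).comap (QuotientGroup.mk' N) := fun T => by
    rw [commutator_le_iff_map_eq_bot,
      Subgroup.map_top_of_surjective _ (QuotientGroup.mk'_surjective N),
      Subgroup.commutator_top_right_eq_bot_iff_le_center, Subgroup.map_le_iff_le_comap]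
  rw [key] at h ⊢
  exact Subgroup.normalClosure_le_normal h

/-- Three subgroups lemma and induction on `m`, with `R` varying: one rotated term needs the
induction hypothesis for `⁅R, ⊤⁆` in place of `R`. -/
theorem commutator_gammaSucc_le (m : ℕ) :
    ∀ (R : Subgroup G) [R.Normal], ⁅R, gammaSucc m G⁆ ≤ engelComm (m + 1) R := by
  induction m with
  | zero => exact fun R _ => by rw [engelComm_succ]; exact le_rfl
  | succ m ih =>
    intro R _
    have hsucc : gammaSucc (m + 1) G = ⁅gammaSucc m G, ⊤⁆ := rfl
    rw [hsucc, Subgroup.commutator_comm]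
    refine commutator_commutator_le_of_rotate ?_ ?_
    · rw [Subgroup.commutator_comm ⊤ R]
      refine (ih _).trans (le_of_eq ?_)
      rw [show ⁅R, ⊤⁆ = engelComm 1 R from (engelComm_succ 0 R).symm, engelComm_add]
      congr 1; omega
    · rw [engelComm_succ]
      exact Subgroup.commutator_mono (ih R) le_rfl

theorem map_gammaSucc_le {H : Type*} [Group H] (c : ℕ) (f : G →* H) :
    (gammaSucc c G).map f ≤ gammaSucc c H := by
  rw [gammaSucc, Subgroup.map_lowerCentralSeries]
  exact Subgroup.lowerCentralSeries_mono c le_top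

theorem map_gammaSucc {H : Type*} [Group H] (c : ℕ) {f : G →* H} (hf : Surjective f) :
    (gammaSucc c G).map f = gammaSucc c H := by
  rw [gammaSucc, Subgroup.map_lowerCentralSeries, Subgroup.map_top_of_surjective f hf, gammaSucc]

theorem map_engelComm_le {H : Type*} [Group H] (c : ℕ) (f : G →* H) {R : Subgroup G}
    {S : Subgroup H} (h : R.map f ≤ S) : (engelComm c R).map f ≤ engelComm c S := by
  induction c with
  | zero => exact h
  | succ c ih =>
    rw [engelComm_succ, engelComm_succ, Subgroup.map_commutator]
    exact Subgroup.commutator_mono ih le_top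

/-- Homomorphisms which agree modulo `R` agree modulo `[R, _c H]` on `γ_{c+1}`. -/
theorem inv_mul_mem_engelComm {H : Type*} [Group H] (φ ψ : G →* H) (R : Subgroup H) [R.Normal]
    (h : ∀ x, (ψ x)⁻¹ * φ x ∈ R) (c : ℕ) :
    ∀ x ∈ gammaSucc c G, (ψ x)⁻¹ * φ x ∈ engelComm c R := by
  induction c with
  | zero => exact fun x _ => h x
  | succ c ih =>
    let q := QuotientGroup.mk' (engelComm (c + 1) R)
    have hq : ∀ u v : H, ⁅u, v⁆ ∈ engelComm (c + 1) R → Commute (q u) (q v) := fun u v huv => by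
      rw [← commutatorElement_eq_one_iff_commute, ← map_commutatorElement]
      exact (QuotientGroup.eq_one_iff _).mpr huv
    -- It suffices to treat generators `⁅y, z⁆` with `y` in `γ_{c+1}`. The error `r` of `y` lies in
    -- `[R, _c H]`, hence is central modulo `[R, _{c+1} H]`; the error `s` of `z` lies only in `R`,
    -- but commutes there with `ψ y`. Both errors cancel from the commutator.
    have hle : gammaSucc (c + 1) G ≤ (q.comp ψ).eqLocus (q.comp φ) := by
      refine Subgroup.commutator_le.mpr fun y hy z _ => ?_
      obtain ⟨r, hr⟩ : ∃ r, r = (ψ y)⁻¹ * φ y := ⟨_, rfl⟩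
      obtain ⟨s, hs⟩ : ∃ s, s = (ψ z)⁻¹ * φ z := ⟨_, rfl⟩
      have hrR : r ∈ engelComm c R := hr ▸ ih y hy
      have hsR : s ∈ R := hs ▸ h z
      have h1 : Commute (q r) (q (φ z)) := hq _ _ <| by
        rw [engelComm_succ]
        exact Subgroup.commutator_mem_commutator hrR (Subgroup.mem_top _)
      have h2 : Commute (q s) (q (ψ y)) := hq _ _ <|
        commutator_gammaSucc_le c R <| Subgroup.commutator_mem_commutator hsR <|
          map_gammaSucc_le c ψ ⟨y, hy, rfl⟩
      have e1 : q (φ y) = q (ψ y) * q r := by rw [hr, ← map_mul, mul_inv_cancel_left]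
      have e2 : q (φ z) = q (ψ z) * q s := by rw [hs, ← map_mul, mul_inv_cancel_left]
      change q (ψ ⁅y, z⁆) = q (φ ⁅y, z⁆)
      simp only [commutatorElement_def, map_mul, map_inv, e1]
      calc q (ψ y) * q (ψ z) * (q (ψ y))⁻¹ * (q (ψ z))⁻¹
          = q (ψ y) * q (ψ z) * (q s * (q (ψ y))⁻¹ * (q s)⁻¹) * (q (ψ z))⁻¹ := by
            rw [h2.inv_right.eq, mul_inv_cancel_right]
        _ = q (ψ y) * q (φ z) * (q (ψ y))⁻¹ * (q (φ z))⁻¹ := by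
            rw [e2]; group
        _ = q (ψ y) * (q r * q (φ z) * (q r)⁻¹) * (q (ψ y))⁻¹ * (q (φ z))⁻¹ := by
            rw [h1.eq, mul_inv_cancel_right]
        _ = _ := by group
    exact fun x hx => (QuotientGroup.eq).mp (hle hx)

end CommutatorCalculus

/-! ### Functoriality of the nilpotent multiplier. -/

section Functoriality

variable {F F' G G' : Type*} [Group F] [Group F'] [Group G] [Group G']

/-- The homomorphism of `c`-nilpotent multipliers induced by a homomorphism of presentations. -/
def nilMultMap (c : ℕ) {π : F →* G} {π' : F' →* G'} (φ : F →* F')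
    (h : ∀ x ∈ π.ker, φ x ∈ π'.ker) : NilMult c π →* NilMult c π' :=
  QuotientGroup.map _ _
    ((φ.comp (Subgroup.subtype _)).codRestrict (π'.ker ⊓ gammaSucc c F') fun x =>
      ⟨h _ x.2.1, map_gammaSucc_le c φ ⟨_, x.2.2, rfl⟩⟩)
    fun x hx => Subgroup.mem_subgroupOf.mpr <|
      map_engelComm_le c φ (Subgroup.map_le_iff_le_comap.mpr h)
        ⟨(x : F), Subgroup.mem_subgroupOf.mp hx, rfl⟩

theorem nilMultMap_mk (c : ℕ) {π : F →* G} {π' : F' →* G'} (φ : F →* F')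
    (h : ∀ x ∈ π.ker, φ x ∈ π'.ker) (x : ↥(π.ker ⊓ gammaSucc c F)) :
    nilMultMap c φ h (QuotientGroup.mk x) = QuotientGroup.mk
      ⟨φ x, h _ x.2.1, map_gammaSucc_le c φ ⟨_, x.2.2, rfl⟩⟩ := rfl

/-- `ψ ∘ φ` agrees with the identity modulo `ker π`, hence modulo `[ker π, _c F]` on `γ_{c+1}(F)`.
Only this composite matters; neither group has to be free. -/
theorem nilMultMap_leftInverse (c : ℕ) {π : F →* G} {π' : F' →* G'} (φ : F →* F')
    (h : ∀ x ∈ π.ker, φ x ∈ π'.ker) (ψ : F' →* F) (h' : ∀ x ∈ π'.ker, ψ x ∈ π.ker)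
    (hψφ : π.comp (ψ.comp φ) = π) : LeftInverse (nilMultMap c ψ h') (nilMultMap c φ h) := by
  intro x
  induction x using QuotientGroup.induction_on with
  | H x =>
    rw [nilMultMap_mk, nilMultMap_mk]
    refine QuotientGroup.eq.mpr (Subgroup.mem_subgroupOf.mpr ?_)
    have := inv_mul_mem_engelComm (MonoidHom.id F) (ψ.comp φ) π.ker (fun x => by
      have hx := DFunLike.congr_fun hψφ x
      simp only [MonoidHom.comp_apply] at hx
      simp [MonoidHom.mem_ker, hx]) c x x.2.2
    simpa using this

instance nilMult_isMulCommutative (c : ℕ) (π : F →* G) : IsMulCommutative (NilMult c π) where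
  is_comm := ⟨fun x y => by
    induction x using QuotientGroup.induction_on with
    | H x =>
      induction y using QuotientGroup.induction_on with
      | H y =>
        rw [← QuotientGroup.mk_mul, ← QuotientGroup.mk_mul]
        refine QuotientGroup.eq.mpr (Subgroup.mem_subgroupOf.mpr ?_)
        have h := engelComm_antitone π.ker c.le_succ <| commutator_gammaSucc_le c π.ker <|
          Subgroup.commutator_mem_commutator (π.ker.inv_mem y.2.1) (inv_mem x.2.2)
        simpa [commutatorElement_def, mul_assoc] using h⟩

theorem exists_lift_of_isFreeGroup [IsFreeGroup F] {p : F' →* G} (hp : Surjective p) (q : F →* G) :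
    ∃ φ : F →* F', p.comp φ = q := by
  choose s hs using hp
  exact ⟨IsFreeGroup.lift fun i => s (q (IsFreeGroup.of i)),
    IsFreeGroup.ext_hom fun i => by simp [hs]⟩

end Functoriality

/-! ### Duality of finite abelian groups. -/

section FiniteAbelian

/-- A quotient of a finite abelian group is isomorphic to a subgroup of it. -/
theorem exists_injective_of_surjective_of_finite {X Y : Type*} [Group X] [IsMulCommutative X]
    [Finite X] [Group Y] (f : X →* Y) (hf : Surjective f) : ∃ g : Y →* X, Injective g := by
  have hY : ∀ a b : Y, a * b = b * a := fun a b => by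
    obtain ⟨x, rfl⟩ := hf a
    obtain ⟨y, rfl⟩ := hf b
    rw [← map_mul, ← map_mul, mul_comm']
  let _ : CommGroup X := { (inferInstance : Group X) with mul_comm := mul_comm' }
  let _ : CommGroup Y := { (inferInstance : Group Y) with mul_comm := hY }
  have : Finite Y := Finite.of_surjective f hf
  -- Each finite abelian group is isomorphic to its character group, and composing with the
  -- surjection `f` embeds the characters of `Y` into those of `X`.
  obtain ⟨eX⟩ := CommGroup.monoidHom_mulEquiv_of_hasEnoughRootsOfUnity X (AlgebraicClosure ℚ)
  obtain ⟨eY⟩ := CommGroup.monoidHom_mulEquiv_of_hasEnoughRootsOfUnity Y (AlgebraicClosure ℚ)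
  have hinj : Injective (MonoidHom.compHom' (P := (AlgebraicClosure ℚ)ˣ) f) :=
    fun φ ψ h => (MonoidHom.cancel_right hf).mp h
  exact ⟨(eX.toMonoidHom.comp (MonoidHom.compHom' f)).comp eY.symm.toMonoidHom,
    eX.injective.comp (hinj.comp eY.symm.injective)⟩

end FiniteAbelian

/-! ### The retraction of `F₁ * B` onto `F₁`, and the map to `E_c / D_c`. -/

section Retraction

variable {A F₁ : Type*} [Group A] [Group F₁] (B : Type*) [Group B] (c : ℕ) (π₁ : F₁ →* A)

theorem freeK_sup_topK : freeK F₁ B ⊔ topK F₁ B = ⊤ := Coprod.range_inl_sup_range_inr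

theorem commutator_top_le_of_freeK_of_topK {S N : Subgroup (Coprod F₁ B)} [N.Normal]
    (hF : ⁅S, freeK F₁ B⁆ ≤ N) (hB : ⁅S, topK F₁ B⁆ ≤ N) : ⁅S, ⊤⁆ ≤ N := by
  rw [← freeK_sup_topK]
  exact commutator_sup_le hF hB

/-- The subgroup `[R₁, _c F₁]` of `K = F₁ * B`. -/
def engelK : Subgroup (Coprod F₁ B) := (engelComm c π₁.ker).map Coprod.inl

theorem engelK_succ : engelK B (c + 1) π₁ = ⁅engelK B c π₁, freeK F₁ B⁆ := by
  rw [engelK, engelComm_succ, Subgroup.map_commutator, freeK, MonoidHom.range_eq_map, engelK]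

theorem engelK_succ_le : engelK B (c + 1) π₁ ≤ engelK B c π₁ :=
  Subgroup.map_mono (engelComm_antitone π₁.ker c.le_succ)

theorem engelK_eq_leftNormed :
    engelK B c π₁ = leftNormed (relK B π₁) (List.replicate c (freeK F₁ B)) := by
  induction c with
  | zero => rfl
  | succ c ih =>
    rw [engelK_succ, ih, List.replicate_succ', leftNormed, leftNormed, List.foldl_append]
    rfl

theorem leftNormed_le_Dc {G : Fin c → Subgroup (Coprod F₁ B)}
    (hG : ∀ i, G i = freeK F₁ B ∨ G i = topK F₁ B) (hB : ∃ j, G j = topK F₁ B) :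
    leftNormed (relK B π₁) (List.ofFn G) ≤ Dc B c π₁ :=
  Subgroup.le_normalClosure.trans <|
    le_iSup₂_of_le (f := fun (G : Fin c → Subgroup (Coprod F₁ B))
      (_ : (∀ i, G i = freeK F₁ B ∨ G i = topK F₁ B) ∧ ∃ j, G j = topK F₁ B) =>
        Subgroup.normalClosure (leftNormed (relK B π₁) (List.ofFn G) : Set (Coprod F₁ B)))
      G ⟨hG, hB⟩ le_rfl

theorem commutator_leftNormed_ofFn_le_Dc {G : Fin c → Subgroup (Coprod F₁ B)}
    {X : Subgroup (Coprod F₁ B)} (hG : ∀ i, G i = freeK F₁ B ∨ G i = topK F₁ B)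
    (hX : X = freeK F₁ B ∨ X = topK F₁ B) (hB : X = topK F₁ B ∨ ∃ j, G j = topK F₁ B) :
    ⁅leftNormed (relK B π₁) (List.ofFn G), X⁆ ≤ Dc B (c + 1) π₁ := by
  have h := leftNormed_le_Dc B (c + 1) π₁ (G := Fin.snoc G X)
    (fun i => by refine Fin.lastCases ?_ (fun i => ?_) i <;> simp [hX, hG])
    (by
      rcases hB with hB | ⟨j, hj⟩
      · exact ⟨Fin.last c, by simpa⟩
      · exact ⟨j.castSucc, by simpa⟩)
  rw [List.ofFn_succ'] at h
  simpa [leftNormed, List.concat_eq_append] using h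

/-- Having commutators with `K` in `D_{c+1}` means lying over the centre of `K / D_{c+1}`, so it can
be tested on each factor of `D_c`, then on its generators. There, bracketing with `F₁` or `B`
appends an entry to a list that already contains `B`. -/
theorem commutator_Dc_le : ⁅Dc B c π₁, ⊤⁆ ≤ Dc B (c + 1) π₁ := by
  rw [Subgroup.commutator_comm, commutator_le_iff_map_eq_bot,
    Subgroup.map_top_of_surjective _ (QuotientGroup.mk'_surjective _),
    Subgroup.commutator_top_left_eq_bot_iff_le_center, Subgroup.map_le_iff_le_comap]
  refine iSup₂_le fun G hG => ?_
  rw [← Subgroup.map_le_iff_le_comap, ← Subgroup.commutator_top_left_eq_bot_iff_le_center,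
    ← Subgroup.map_top_of_surjective _ (QuotientGroup.mk'_surjective (Dc B (c + 1) π₁)),
    ← commutator_le_iff_map_eq_bot, Subgroup.commutator_comm]
  exact commutator_normalClosure_top_le <| commutator_top_le_of_freeK_of_topK B
    (commutator_leftNormed_ofFn_le_Dc B c π₁ hG.1 (.inl rfl) (.inr hG.2))
    (commutator_leftNormed_ofFn_le_Dc B c π₁ hG.1 (.inr rfl) (.inl rfl))

theorem commutator_engelK_topK_le_Dc : ⁅engelK B c π₁, topK F₁ B⁆ ≤ Dc B (c + 1) π₁ := by
  have h := commutator_leftNormed_ofFn_le_Dc B c π₁ (G := fun _ => freeK F₁ B) (X := topK F₁ B)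
    (fun _ => .inl rfl) (.inr rfl) (.inl rfl)
  rwa [List.ofFn_const, ← engelK_eq_leftNormed] at h

theorem engelComm_Dc_le (m n : ℕ) : engelComm n (Dc B m π₁) ≤ Dc B (m + n) π₁ := by
  induction n with
  | zero => exact le_rfl
  | succ n ih =>
    rw [engelComm_succ]
    exact (Subgroup.commutator_mono ih le_rfl).trans (commutator_Dc_le B _ π₁)

/-- `F₁` normalises `[R₁, _c F₁]`, and `B` centralises it modulo `D`; together they generate `K`. -/
theorem engelK_sup_normal {D : Subgroup (Coprod F₁ B)} [D.Normal]
    (h : ⁅engelK B c π₁, topK F₁ B⁆ ≤ D) : (engelK B c π₁ ⊔ D).Normal := by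
  rw [← Subgroup.commutator_top_right_le_iff, ← Subgroup.le_normalizer_iff_commutator_le_left,
    ← freeK_sup_topK]
  refine sup_le (le_trans (le_inf ?_ ?_) (Subgroup.normalizer_inf_normalizer_le_normalizer_sup _ _))
    ?_
  · rw [Subgroup.le_normalizer_iff_commutator_le_left, ← engelK_succ]
    exact engelK_succ_le B c π₁
  · rw [Subgroup.normalizer_eq_top]
    exact le_top
  · rw [Subgroup.le_normalizer_iff_commutator_le_right]
    refine le_trans ?_ le_sup_right
    rw [Subgroup.commutator_comm] at h
    exact commutator_sup_le h (Subgroup.commutator_le_right _ _)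

/-- In the inductive step, bracketing `[R₁, _c F₁]` with `F₁` lengthens it, while bracketing with
`B` lands in `D_{c+1}`. The normal closure is needed for `c = 0`, where `D_0` is trivial; for
positive `c` the next lemma removes it. -/
theorem engelComm_normalClosure_relK_le :
    engelComm c (Subgroup.normalClosure (relK B π₁ : Set (Coprod F₁ B))) ≤
      Subgroup.normalClosure (engelK B c π₁ : Set (Coprod F₁ B)) ⊔ Dc B c π₁ := by
  induction c with
  | zero => exact le_sup_left
  | succ c ih =>
    rw [engelComm_succ]
    refine (Subgroup.commutator_mono ih le_rfl).trans ?_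
    rw [Subgroup.commutator_comm]
    refine commutator_sup_le ?_ ?_
    · rw [Subgroup.commutator_comm]
      refine commutator_normalClosure_top_le (commutator_top_le_of_freeK_of_topK B ?_ ?_)
      · rw [← engelK_succ]
        exact Subgroup.le_normalClosure.trans le_sup_left
      · exact (commutator_engelK_topK_le_Dc B c π₁).trans le_sup_right
    · rw [Subgroup.commutator_comm]
      exact (commutator_Dc_le B c π₁).trans le_sup_right

theorem engelComm_succ_normalClosure_relK_le :
    engelComm (c + 1) (Subgroup.normalClosure (relK B π₁ : Set (Coprod F₁ B))) ≤
      engelK B (c + 1) π₁ ⊔ Dc B (c + 1) π₁ := by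
  have hn := engelK_sup_normal B (c + 1) π₁ (D := Dc B (c + 1) π₁) <|
    (Subgroup.commutator_mono (engelK_succ_le B c π₁) le_rfl).trans
      (commutator_engelK_topK_le_Dc B c π₁)
  exact (engelComm_normalClosure_relK_le B (c + 1) π₁).trans <|
    sup_le (Subgroup.normalClosure_le_normal (SetLike.coe_subset_coe.mpr le_sup_left))
      le_sup_right

theorem normalClosure_relK_le :
    Subgroup.normalClosure (relK B π₁ : Set (Coprod F₁ B)) ≤ relK B π₁ ⊔ Dc B 1 π₁ := by
  have hn : (relK B π₁ ⊔ Dc B 1 π₁).Normal :=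
    engelK_sup_normal B 0 π₁ (commutator_engelK_topK_le_Dc B 0 π₁)
  exact Subgroup.normalClosure_le_normal (SetLike.coe_subset_coe.mpr le_sup_left)

theorem commutator_freeK_topK_le_ker_fst :
    ⁅freeK F₁ B, topK F₁ B⁆ ≤ (Coprod.fst : Coprod F₁ B →* F₁).ker := by
  rw [← Subgroup.map_eq_bot_iff, Subgroup.map_commutator,
    (Subgroup.map_eq_bot_iff (f := (Coprod.fst : Coprod F₁ B →* F₁)) (topK F₁ B)).mpr,
    Subgroup.commutator_bot_right]
  rintro _ ⟨b, rfl⟩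
  simp [MonoidHom.mem_ker]

theorem fst_eq_one_of_mem_Dc {d : Coprod F₁ B} (hd : d ∈ Dc B c π₁) : Coprod.fst d = 1 :=
  commutator_freeK_topK_le_ker_fst B ((Dc_le_Ec B c π₁ hd).2)

/-- An element of `X · D_n`, where `X` lies in the copy of `F₁`, is the product of its retract onto
`F₁` with an element of `D_n`. -/
theorem retract_inv_mul_mem_Dc {X : Subgroup (Coprod F₁ B)} (hX : X ≤ freeK F₁ B)
    {z : Coprod F₁ B} (hz : z ∈ X ⊔ Dc B c π₁) :
    (Coprod.inl (Coprod.fst z))⁻¹ * z ∈ Dc B c π₁ := by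
  obtain ⟨x, hx, d, hd, rfl⟩ := Subgroup.mem_sup_of_normal_right.mp hz
  obtain ⟨y, rfl⟩ := hX hx
  simpa [fst_eq_one_of_mem_Dc B c π₁ hd] using hd

theorem relK_le_freeK : relK B π₁ ≤ freeK F₁ B := by
  rintro _ ⟨x, -, rfl⟩
  exact ⟨x, rfl⟩

theorem engelK_le_freeK : engelK B c π₁ ≤ freeK F₁ B := by
  rintro _ ⟨x, -, rfl⟩
  exact ⟨x, rfl⟩

theorem Ec_le_normalClosure_relK :
    Ec B c π₁ ≤ Subgroup.normalClosure (relK B π₁ : Set (Coprod F₁ B)) :=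
  inf_le_left.trans <| inf_le_left.trans <| Subgroup.normalClosure_le_normal <|
    (Subgroup.commutator_mono Subgroup.le_normalClosure le_rfl).trans
      (Subgroup.commutator_le_left _ _)

/-- `E_c` lies in `R₁^K = R₁ D_1`, and the retraction kills it because it lies in `[F₁, B]`; so the
`R₁` part vanishes. -/
theorem Ec_le_Dc_one : Ec B c π₁ ≤ Dc B 1 π₁ := fun x hx => by
  have h := retract_inv_mul_mem_Dc B 1 π₁ (relK_le_freeK B π₁) <|
    normalClosure_relK_le B π₁ (Ec_le_normalClosure_relK B c π₁ hx)
  have h1 : Coprod.fst x = 1 := commutator_freeK_topK_le_ker_fst B hx.2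
  simpa [h1] using h

/-- Since `E_c ≤ D_1`, bracketing with `γ_{c+1}(K)` gives at least `c - 1` further commutations with
`K`, which lead from `D_1` to `D_c`. -/
theorem commutator_Ec_gammaSucc_le (hc : 1 ≤ c) :
    ⁅Ec B c π₁, gammaSucc c (Coprod F₁ B)⁆ ≤ Dc B c π₁ := by
  obtain ⟨m, rfl⟩ := Nat.exists_eq_add_of_le' hc
  refine (Subgroup.commutator_mono (Ec_le_Dc_one B _ π₁) le_rfl).trans ?_
  refine (commutator_gammaSucc_le _ _).trans ?_
  refine (engelComm_antitone (Dc B 1 π₁) (show m ≤ m + 1 + 1 by omega)).trans ?_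
  rw [add_comm m 1]
  exact engelComm_Dc_le B π₁ 1 m

/-- The homomorphism `F₁ * B → A * B`. -/
def relHom : Coprod F₁ B →* Coprod A B := Coprod.map π₁ (MonoidHom.id B)

variable {π₁}

/-- The quotient map of `K` by `R₁^K` factors through `A * B`, since it kills `R₁`. -/
theorem ker_relHom (hπ₁ : Surjective π₁) :
    (relHom B π₁).ker = Subgroup.normalClosure (relK B π₁ : Set (Coprod F₁ B)) := by
  refine le_antisymm (fun x hx => ?_) (Subgroup.normalClosure_le_normal ?_)
  · let q := QuotientGroup.mk' (Subgroup.normalClosure (relK B π₁ : Set (Coprod F₁ B)))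
    have hq : π₁.ker ≤ (q.comp Coprod.inl).ker := fun r hr =>
      (QuotientGroup.eq_one_iff _).mpr (Subgroup.le_normalClosure ⟨r, hr, rfl⟩)
    have h : (Coprod.lift (π₁.liftOfRightInverse _ (rightInverse_surjInv hπ₁) ⟨_, hq⟩)
        (q.comp Coprod.inr)).comp (relHom B π₁) = q :=
      Coprod.hom_ext
        (MonoidHom.ext fun r => by
          simp [relHom, MonoidHom.liftOfRightInverse_comp_apply])
        (MonoidHom.ext fun b => by simp [relHom])
    have h' := DFunLike.congr_fun h x
    rw [MonoidHom.comp_apply, MonoidHom.mem_ker.mp hx, map_one] at h'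
    exact (QuotientGroup.eq_one_iff _).mp h'.symm
  · rintro _ ⟨r, hr, rfl⟩
    simp only [SetLike.mem_coe, MonoidHom.mem_ker] at hr ⊢
    simp [relHom, hr]

theorem retract_inv_mul_mem_Ec (hπ₁ : Surjective π₁) {z : Coprod F₁ B}
    (hz : z ∈ (relHom B π₁).ker ⊓ gammaSucc c (Coprod F₁ B)) :
    (Coprod.inl (Coprod.fst z))⁻¹ * z ∈ Ec B c π₁ := by
  have hD := Dc_le_Ec B 1 π₁ <| retract_inv_mul_mem_Dc B 1 π₁ (relK_le_freeK B π₁) <|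
    normalClosure_relK_le B π₁ <| ker_relHom B hπ₁ ▸ hz.1
  refine ⟨⟨hD.1.1, Subgroup.mul_mem _ (Subgroup.inv_mem _ ?_) hz.2⟩, hD.2⟩
  exact map_gammaSucc_le c (Coprod.inl.comp Coprod.fst) ⟨z, hz.2, rfl⟩

/-- The epimorphism from the `c`-nilpotent multiplier of the presentation `F₁ * B → A * B`, which is
relative to `B`, onto `E_c / D_c`. -/
def toSec (hc : 1 ≤ c) (hπ₁ : Surjective π₁) :
    NilMult c (relHom B π₁) →* Sec (Ec B c π₁) (Dc B c π₁) :=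
  QuotientGroup.lift _
    (MonoidHom.mk' (fun z => QuotientGroup.mk ⟨_, retract_inv_mul_mem_Ec B c hπ₁ z.2⟩)
      fun z w => QuotientGroup.eq.mpr <| Subgroup.mem_subgroupOf.mpr <| by
        have hw : Coprod.inl (Coprod.fst (w : Coprod F₁ B)) ∈ gammaSucc c (Coprod F₁ B) :=
          map_gammaSucc_le c (Coprod.inl.comp Coprod.fst) ⟨_, w.2.2, rfl⟩
        -- With `e = z̄⁻¹ z`, the failure of multiplicativity is exactly `w⁻¹ ⁅e⁻¹, w̄⁆ w`.
        have h := (Dc_normal B c π₁).conj_mem _ (commutator_Ec_gammaSucc_le B c π₁ hc <|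
          Subgroup.commutator_mem_commutator
            (inv_mem (retract_inv_mul_mem_Ec B c hπ₁ z.2)) hw)
          (w : Coprod F₁ B)⁻¹
        simp only [commutatorElement_def] at h
        convert h using 1
        simp only [Subgroup.coe_mul, InvMemClass.coe_inv, map_mul]
        group)
    fun z hz => (QuotientGroup.eq_one_iff _).mpr <| Subgroup.mem_subgroupOf.mpr <| by
      obtain ⟨m, rfl⟩ := Nat.exists_eq_add_of_le' hc
      have h : (z : Coprod F₁ B) ∈
          engelComm (m + 1) (Subgroup.normalClosure (relK B π₁ : Set (Coprod F₁ B))) :=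
        ker_relHom B hπ₁ ▸ Subgroup.mem_subgroupOf.mp hz
      exact retract_inv_mul_mem_Dc B _ π₁ (engelK_le_freeK B _ π₁)
        (engelComm_succ_normalClosure_relK_le B m π₁ h)

end Retraction

/-! ### The isomorphism of `A Wr_* B` with `A * B`, and finiteness. -/

section WreathCoprod

variable (A B : Type*) [Group A] [Group B]

/-- The homomorphism from the free product of the `A_b` to `A * B` that sends `a_b` to `b⁻¹ a b`. -/
def freePowerToCoprod : FreePower A B →* Coprod A B :=
  CoprodI.lift fun b => (MulAut.conj (Coprod.inr b⁻¹ : Coprod A B)).toMonoidHom.comp Coprod.inl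

theorem freePowerToCoprod_copy (b : B) (a : A) :
    freePowerToCoprod A B (copy b a) = (Coprod.inr b)⁻¹ * Coprod.inl a * Coprod.inr b := by
  simp [freePowerToCoprod, copy]

/-- The homomorphism `A Wr_* B → A * B` which sends `a_b` to `b⁻¹ a b`. -/
def wreathToCoprod : FreeWreath A B →* Coprod A B :=
  SemidirectProduct.lift (freePowerToCoprod A B) Coprod.inr fun b => freePower_hom_ext fun x a => by
    simp [shiftAut, shift_copy, freePowerToCoprod_copy, mul_assoc]

/-- The homomorphism `A * B → A Wr_* B` which sends `a` to `a_1`. -/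
def coprodToWreath : Coprod A B →* FreeWreath A B :=
  Coprod.lift (SemidirectProduct.inl.comp (CoprodI.of (M := fun _ : B => A) (i := 1)))
    SemidirectProduct.inr

theorem wreathToCoprod_comp_coprodToWreath :
    (wreathToCoprod A B).comp (coprodToWreath A B) = MonoidHom.id _ :=
  Coprod.hom_ext (MonoidHom.ext fun a => by
      simpa [wreathToCoprod, coprodToWreath, copy] using freePowerToCoprod_copy A B 1 a)
    (MonoidHom.ext fun b => by simp [wreathToCoprod, coprodToWreath])

theorem coprodToWreath_comp_wreathToCoprod :
    (coprodToWreath A B).comp (wreathToCoprod A B) = MonoidHom.id _ := by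
  refine SemidirectProduct.hom_ext (freePower_hom_ext fun b a => ?_) (MonoidHom.ext fun b => ?_)
  · have h := inr_inv_mul_copy_mul_inr b 1 a
    rw [one_mul] at h
    simp only [MonoidHom.comp_apply, MonoidHom.id_apply, wreathToCoprod,
      SemidirectProduct.lift_inl, freePowerToCoprod_copy]
    rw [← h]
    simp [coprodToWreath, copy]
  · simp [wreathToCoprod, coprodToWreath]

variable {A B}

/-- The words alternating between `a_1` and `a_b` are reduced, and there is one of each length. -/
theorem infinite_freePower {a : A} (ha : a ≠ 1) {b : B} (hb : b ≠ 1) :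
    Infinite (FreePower A B) := by
  classical
  let l : ℕ → (Σ _ : B, A) := fun k => if Even k then ⟨1, a⟩ else ⟨b, a⟩
  let w : ℕ → CoprodI.Word (fun _ : B => A) := fun n =>
    { toList := (List.range n).map l
      ne_one := fun x hx => by
        obtain ⟨k, -, rfl⟩ := List.mem_map.mp hx
        by_cases hk : Even k <;> simp [l, hk, ha]
      chain_ne := by
        rw [List.isChain_map, List.isChain_range]
        intro k _
        by_cases hk : Even k <;> simp [l, hk, hb, hb.symm, Nat.even_add_one] }
  have hw : Injective w := fun m n h => by
    simpa [w] using congrArg (fun v => v.toList.length) h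
  exact Infinite.of_injective _ (CoprodI.Word.equiv.symm.injective.comp hw)

theorem subsingleton_or_of_finite_freeWreath [Finite (FreeWreath A B)] :
    Subsingleton A ∨ Subsingleton B := by
  by_contra! h
  obtain ⟨hA, hB⟩ := h
  obtain ⟨a, ha⟩ := exists_ne (1 : A)
  obtain ⟨b, hb⟩ := exists_ne (1 : B)
  have := infinite_freePower ha hb
  exact not_finite_iff_infinite.mpr
    (Infinite.of_injective (SemidirectProduct.inl (φ := shiftAut A B))
      SemidirectProduct.inl_injective) ‹_›

end WreathCoprod

/-! ### The epimorphism for the presentation `F₁ * F₂ → A * B`. -/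

section CoprodPresentation

variable {A B F₁ F₂ : Type*} [Group A] [Group B] [Group F₁] [Group F₂] (c : ℕ)
  {π₁ : F₁ →* A} {π₂ : F₂ →* B}

variable (π₁ π₂) in
theorem apply_fst (x : Coprod F₁ F₂) : π₁ (Coprod.fst x) = Coprod.fst (Coprod.map π₁ π₂ x) :=
  DFunLike.congr_fun (f := π₁.comp Coprod.fst) (g := Coprod.fst.comp (Coprod.map π₁ π₂))
    (Coprod.hom_ext (MonoidHom.ext fun _ => by simp) (MonoidHom.ext fun _ => by simp)) x

variable (π₁ π₂) in
theorem apply_snd (x : Coprod F₁ F₂) : π₂ (Coprod.snd x) = Coprod.snd (Coprod.map π₁ π₂ x) :=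
  DFunLike.congr_fun (f := π₂.comp Coprod.snd) (g := Coprod.snd.comp (Coprod.map π₁ π₂))
    (Coprod.hom_ext (MonoidHom.ext fun _ => by simp) (MonoidHom.ext fun _ => by simp)) x

theorem fst_mem_ker {x : Coprod F₁ F₂} (hx : x ∈ (Coprod.map π₁ π₂).ker) :
    Coprod.fst x ∈ π₁.ker := by
  rw [MonoidHom.mem_ker, apply_fst π₁ π₂, MonoidHom.mem_ker.mp hx, map_one]

theorem snd_mem_ker {x : Coprod F₁ F₂} (hx : x ∈ (Coprod.map π₁ π₂).ker) :
    Coprod.snd x ∈ π₂.ker := by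
  rw [MonoidHom.mem_ker, apply_snd π₁ π₂, MonoidHom.mem_ker.mp hx, map_one]

variable (π₁ π₂) in
theorem relHom_map (x : Coprod F₁ F₂) :
    relHom B π₁ (Coprod.map (MonoidHom.id F₁) π₂ x) = Coprod.map π₁ π₂ x := by
  rw [relHom, Coprod.map_map]
  rfl

theorem map_mem_ker_relHom {x : Coprod F₁ F₂} (hx : x ∈ (Coprod.map π₁ π₂).ker) :
    Coprod.map (MonoidHom.id F₁) π₂ x ∈ (relHom B π₁).ker := by
  rw [MonoidHom.mem_ker, relHom_map]
  exact hx

theorem coprodMap_surjective {M N P Q : Type*} [Group M] [Group N] [Group P] [Group Q]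
    {f : M →* P} {g : N →* Q} (hf : Surjective f) (hg : Surjective g) :
    Surjective (Coprod.map f g) := by
  intro x
  induction x using Coprod.induction_on with
  | inl m => obtain ⟨y, rfl⟩ := hf m; exact ⟨Coprod.inl y, by simp⟩
  | inr n => obtain ⟨y, rfl⟩ := hg n; exact ⟨Coprod.inr y, by simp⟩
  | mul x y hx hy =>
    obtain ⟨x, rfl⟩ := hx
    obtain ⟨y, rfl⟩ := hy
    exact ⟨x * y, map_mul _ _ _⟩

/-- The epimorphism `𝒩_c M(A * B) → 𝒩_c M(A) ⊕ 𝒩_c M(B) ⊕ E_c / D_c`, in terms of the presentation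
`F₁ * F₂ → A * B`. -/
def coprodEpi (hc : 1 ≤ c) (hπ₁ : Surjective π₁) (π₂ : F₂ →* B) :
    NilMult c (Coprod.map π₁ π₂) →*
      NilMult c π₁ × NilMult c π₂ × Sec (Ec B c π₁) (Dc B c π₁) :=
  (nilMultMap c Coprod.fst fun _ => fst_mem_ker).prod <|
    (nilMultMap c Coprod.snd fun _ => snd_mem_ker).prod <|
      (toSec B c hc hπ₁).comp
        (nilMultMap c (Coprod.map (MonoidHom.id F₁) π₂) fun _ => map_mem_ker_relHom)

theorem coprodEpi_surjective (hc : 1 ≤ c) (hπ₁ : Surjective π₁) (hπ₂ : Surjective π₂) :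
    Surjective (coprodEpi c hc hπ₁ π₂) := by
  have hinl : ∀ u : NilMult c π₁, (u, 1, 1) ∈ (coprodEpi c hc hπ₁ π₂).range := fun u => by
    induction u using QuotientGroup.induction_on with
    | H r =>
      refine ⟨QuotientGroup.mk ⟨Coprod.inl r, ?_, map_gammaSucc_le c Coprod.inl ⟨_, r.2.2, rfl⟩⟩,
        Prod.ext rfl (Prod.ext ?_ ?_)⟩
      · change Coprod.map π₁ π₂ _ = 1
        rw [Coprod.map_apply_inl, MonoidHom.mem_ker.mp r.2.1, map_one]
      · refine (QuotientGroup.eq_one_iff _).mpr (Subgroup.mem_subgroupOf.mpr ?_)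
        exact one_mem (engelComm c π₂.ker)
      · refine (QuotientGroup.eq_one_iff _).mpr (Subgroup.mem_subgroupOf.mpr ?_)
        change (Coprod.inl (Coprod.fst (Coprod.map (MonoidHom.id F₁) π₂ (Coprod.inl r))))⁻¹ *
          Coprod.map (MonoidHom.id F₁) π₂ (Coprod.inl r) ∈ Dc B c π₁
        simp [one_mem]
  have hinr : ∀ v : NilMult c π₂, (1, v, 1) ∈ (coprodEpi c hc hπ₁ π₂).range := fun v => by
    induction v using QuotientGroup.induction_on with
    | H r =>
      refine ⟨QuotientGroup.mk ⟨Coprod.inr r, ?_, map_gammaSucc_le c Coprod.inr ⟨_, r.2.2, rfl⟩⟩,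
        Prod.ext ?_ (Prod.ext rfl ?_)⟩
      · change Coprod.map π₁ π₂ _ = 1
        rw [Coprod.map_apply_inr, MonoidHom.mem_ker.mp r.2.1, map_one]
      · refine (QuotientGroup.eq_one_iff _).mpr (Subgroup.mem_subgroupOf.mpr ?_)
        exact one_mem (engelComm c π₁.ker)
      · refine (QuotientGroup.eq_one_iff _).mpr (Subgroup.mem_subgroupOf.mpr ?_)
        change (Coprod.inl (Coprod.fst (Coprod.map (MonoidHom.id F₁) π₂ (Coprod.inr r))))⁻¹ *
          Coprod.map (MonoidHom.id F₁) π₂ (Coprod.inr r) ∈ Dc B c π₁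
        simp [MonoidHom.mem_ker.mp r.2.1, one_mem]
  -- A representative of `s` lifts to `γ_{c+1}(F₁ * F₂)`. The lift has trivial projection to `F₁`,
  -- but its projection to `F₂` is not controlled, so `v` is left free and corrected at the end by
  -- `hinr`.
  have hsec : ∀ s, ∃ v, (1, v, s) ∈ (coprodEpi c hc hπ₁ π₂).range := fun s => by
    induction s using QuotientGroup.induction_on with
    | H e =>
      obtain ⟨e, he⟩ := e
      have hsurj := coprodMap_surjective (f := MonoidHom.id F₁) surjective_id hπ₂
      obtain ⟨x, hx, rfl⟩ : e ∈ (gammaSucc c _).map (Coprod.map (MonoidHom.id F₁) π₂) :=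
        map_gammaSucc c hsurj ▸ he.1.2
      have hfst : Coprod.fst (Coprod.map (MonoidHom.id F₁) π₂ x) = 1 :=
        commutator_freeK_topK_le_ker_fst B he.2
      have hfst' : Coprod.fst x = 1 := by
        have h : (Coprod.fst.comp (Coprod.map (MonoidHom.id F₁) π₂)) = Coprod.fst :=
          Coprod.hom_ext (MonoidHom.ext fun _ => by simp) (MonoidHom.ext fun _ => by simp)
        exact (DFunLike.congr_fun h x).symm.trans hfst
      have hker : x ∈ (Coprod.map π₁ π₂).ker := by
        rw [MonoidHom.mem_ker, ← relHom_map, ← MonoidHom.mem_ker, ker_relHom B hπ₁]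
        exact Ec_le_normalClosure_relK B c π₁ he
      refine ⟨nilMultMap c Coprod.snd (fun _ => snd_mem_ker) (QuotientGroup.mk ⟨x, hker, hx⟩),
        QuotientGroup.mk ⟨x, hker, hx⟩, Prod.ext ?_ (Prod.ext rfl ?_)⟩
      · refine (QuotientGroup.eq_one_iff _).mpr (Subgroup.mem_subgroupOf.mpr ?_)
        change Coprod.fst x ∈ engelComm c π₁.ker
        exact hfst' ▸ one_mem _
      · change QuotientGroup.mk _ = QuotientGroup.mk _
        congr 1
        refine Subtype.ext ?_
        change (Coprod.inl (Coprod.fst (Coprod.map (MonoidHom.id F₁) π₂ x)))⁻¹ *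
          Coprod.map (MonoidHom.id F₁) π₂ x = _
        simp [hfst]
  rintro ⟨u, v, s⟩
  obtain ⟨v', hv'⟩ := hsec s
  have h := mul_mem (hinl u) (mul_mem (hinr (v * v'⁻¹)) hv')
  simpa using h

end CoprodPresentation

end FreeWreathBaer

end

/-! ### Transfer to an arbitrary presentation of `A Wr_* B`. -/

open FreeWreathBaer in
theorem theorem5p3
    {A B F₁ F₂ F : Type*} [Group A] [Group B] [Group F₁] [Group F₂] [Group F]
    [IsFreeGroup F₁] [IsFreeGroup F₂] [IsFreeGroup F]
    (c : ℕ) (hc : 1 ≤ c)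
    (π₁ : F₁ →* A) (hπ₁ : Function.Surjective π₁)
    (π₂ : F₂ →* B) (hπ₂ : Function.Surjective π₂)
    (π : F →* FreeWreath A B) (hπ : Function.Surjective π) :
    (∃ f : NilMult c π →* NilMult c π₁ × NilMult c π₂ × Sec (Ec B c π₁) (Dc B c π₁),
      Function.Surjective f) ∧
    (Finite (FreeWreath A B) ∨ Finite (NilMult c π) →
      ∃ g : NilMult c π₁ × NilMult c π₂ × Sec (Ec B c π₁) (Dc B c π₁) →* NilMult c π,
        Function.Injective g) := by
  obtain ⟨φ, hφ⟩ := exists_lift_of_isFreeGroup (coprodMap_surjective hπ₁ hπ₂)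
    ((wreathToCoprod A B).comp π)
  obtain ⟨ψ₁, hψ₁⟩ := exists_lift_of_isFreeGroup hπ
    ((coprodToWreath A B).comp (Monoid.Coprod.inl.comp π₁))
  obtain ⟨ψ₂, hψ₂⟩ := exists_lift_of_isFreeGroup hπ
    ((coprodToWreath A B).comp (Monoid.Coprod.inr.comp π₂))
  let ψ := Monoid.Coprod.lift ψ₁ ψ₂
  have hψ : π.comp ψ = (coprodToWreath A B).comp (Monoid.Coprod.map π₁ π₂) :=
    Monoid.Coprod.hom_ext hψ₁ hψ₂
  have hφker : ∀ x ∈ π.ker, φ x ∈ (Monoid.Coprod.map π₁ π₂).ker := fun x hx => by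
    have h := DFunLike.congr_fun hφ x
    rwa [MonoidHom.comp_apply, MonoidHom.comp_apply, MonoidHom.mem_ker.mp hx, map_one] at h
  have hψker : ∀ x ∈ (Monoid.Coprod.map π₁ π₂).ker, ψ x ∈ π.ker := fun x hx => by
    have h := DFunLike.congr_fun hψ x
    rwa [MonoidHom.comp_apply, MonoidHom.comp_apply, MonoidHom.mem_ker.mp hx, map_one] at h
  let f := (coprodEpi c hc hπ₁ π₂).comp (nilMultMap c φ hφker)
  -- `φ ∘ ψ` lies over the identity of `A * B`, so the map induced by `ψ` is a right inverse of the
  -- one induced by `φ`.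
  have hf : Function.Surjective f := by
    refine (coprodEpi_surjective c hc hπ₁ hπ₂).comp
      (nilMultMap_leftInverse c ψ hψker φ hφker ?_).surjective
    rw [← MonoidHom.comp_assoc, hφ, MonoidHom.comp_assoc, hψ, ← MonoidHom.comp_assoc,
      wreathToCoprod_comp_coprodToWreath, MonoidHom.id_comp]
  refine ⟨⟨f, hf⟩, ?_⟩
  rintro (hfin | hfin)
  · have hπφ : ∀ x, coprodToWreath A B (Monoid.Coprod.map π₁ π₂ (φ x)) = π x := fun x => by
      have h1 := DFunLike.congr_fun hφ x
      have h2 := DFunLike.congr_fun (coprodToWreath_comp_wreathToCoprod A B) (π x)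
      simp only [MonoidHom.comp_apply, MonoidHom.id_apply] at h1 h2
      rw [h1, h2]
    -- When one factor is trivial, `A * B` is the other factor, and a single component of `f` is
    -- already injective: `ψ₂` or `ψ₁` induces a left inverse of it.
    have hinj : Function.Injective f := by
      rcases subsingleton_or_of_finite_freeWreath (A := A) (B := B) with hA | hB
      · have hker : ∀ x ∈ π₂.ker, ψ₂ x ∈ π.ker := fun x hx => by
          have h := DFunLike.congr_fun hψ₂ x
          simpa [MonoidHom.mem_ker.mp hx] using h
        have hinr : (Monoid.Coprod.inr.comp Monoid.Coprod.snd : Monoid.Coprod A B →* _) =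
            MonoidHom.id _ :=
          Monoid.Coprod.hom_ext (MonoidHom.ext fun a => by simp [Subsingleton.elim a 1])
            (MonoidHom.ext fun _ => by simp)
        have hli := nilMultMap_leftInverse c (Monoid.Coprod.snd.comp φ)
          (fun x hx => snd_mem_ker (hφker x hx)) ψ₂ hker <| MonoidHom.ext fun x => by
            have h1 := DFunLike.congr_fun hψ₂ (Monoid.Coprod.snd (φ x))
            have h2 := DFunLike.congr_fun hinr (Monoid.Coprod.map π₁ π₂ (φ x))
            simp only [MonoidHom.comp_apply, MonoidHom.id_apply] at h1 h2 ⊢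
            rw [h1, apply_snd π₁ π₂, h2, hπφ]
        have hcomp : (fun y => (f y).2.1) = nilMultMap c (Monoid.Coprod.snd.comp φ)
            (fun x hx => snd_mem_ker (hφker x hx)) := by
          funext y
          induction y using QuotientGroup.induction_on with
          | H y => rfl
        exact Function.Injective.of_comp (f := fun p => p.2.1)
          (show Function.Injective (fun y => _) from hcomp.symm ▸ hli.injective)
      · have hker : ∀ x ∈ π₁.ker, ψ₁ x ∈ π.ker := fun x hx => by
          have h := DFunLike.congr_fun hψ₁ x
          simpa [MonoidHom.mem_ker.mp hx] using h
        have hinl : (Monoid.Coprod.inl.comp Monoid.Coprod.fst : Monoid.Coprod A B →* _) =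
            MonoidHom.id _ :=
          Monoid.Coprod.hom_ext (MonoidHom.ext fun _ => by simp)
            (MonoidHom.ext fun b => by simp [Subsingleton.elim b 1])
        have hli := nilMultMap_leftInverse c (Monoid.Coprod.fst.comp φ)
          (fun x hx => fst_mem_ker (hφker x hx)) ψ₁ hker <| MonoidHom.ext fun x => by
            have h1 := DFunLike.congr_fun hψ₁ (Monoid.Coprod.fst (φ x))
            have h2 := DFunLike.congr_fun hinl (Monoid.Coprod.map π₁ π₂ (φ x))
            simp only [MonoidHom.comp_apply, MonoidHom.id_apply] at h1 h2 ⊢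
            rw [h1, apply_fst π₁ π₂, h2, hπφ]
        have hcomp : (fun y => (f y).1) = nilMultMap c (Monoid.Coprod.fst.comp φ)
            (fun x hx => fst_mem_ker (hφker x hx)) := by
          funext y
          induction y using QuotientGroup.induction_on with
          | H y => rfl
        exact Function.Injective.of_comp (f := Prod.fst)
          (show Function.Injective (fun y => _) from hcomp.symm ▸ hli.injective)
    exact ⟨(MulEquiv.ofBijective f ⟨hinj, hf⟩).symm.toMonoidHom, MulEquiv.injective _⟩
  · exact exists_injective_of_surjective_of_finite f hf
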